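/- Let $d\ge 1$, let $\lambda_1,\dots,\lambda_d\in\mathbb R$ with $|\lambda_i|\ne 1$ for all $i$, and let $A=\operatorname{diag}(\lambda_1,\dots,\lambda_d)$. Consider the system $$\mathbf X[n+1]=A\,\mathbf X[n]+\mathbf B[n]\,u[n],\qquad n=0,1,2,\dots,$$ with state $\mathbf X[n]\in\mathbb R^d$, fixed initial state $\mathbf X[0]=x_0$, and random directions $\mathbf B[0],\mathbf B[1],\dots$ that are i.i.d. uniform on the unit sphere of $\mathbb R^d$. At each time $n$ the scalar control is selected as $u[n]=g_n\big(\mathbf B[0],\dots,\mathbf B[n],\mathbf X[0],\dots,\mathbf X[n],u[0],\dots,u[n-1]\big)\in\mathbb R$ with a (measurable) function $g_n$. The system is called second-moment stabilizable if for every initial state $x_0\in\mathbb R^d$ there is a control strategy $(g_n)_{n\ge 0}$ such that $$\limsup_{n\to\infty}\mathbb E\big[\mathbf X[n]^T\mathbf X[n]\big]<\infty .$$ Let $m$ be the number of indices $i$ with $|\lambda_i|>1$, and set $$r=\frac{m-1}{\sum_{i:\,|\lambda_i|>1}\lambda_i^{-2}}$$ (with $r=0$ if $m=0$). If $r<1$,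 then the system is second-moment stabilizable. Conversely, if the system is second-moment stabilizable, then $r\le 1$. -/

import Mathlib

open MeasureTheory ProbabilityTheory Filter
open scoped ENNReal Matrix

/-- The uniform probability distribution on the unit sphere of `ℝ^d` (for `1 ≤ d`): draw the
coordinates i.i.d. from the standard normal distribution, then normalize. -/
noncomputable def uniformSphere (d : ℕ) : Measure (EuclideanSpace ℝ (Fin d)) :=
  (Measure.pi fun _ : Fin d => gaussianReal 0 1).map
    fun x => ‖WithLp.toLp 2 x‖⁻¹ • WithLp.toLp 2 x

/-- What the controller sees at time `n`, before it selects the control `u[n]`: the actuation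
directions `B[0], …, B[n]`, the observed states `X[0], …, X[n]`, and the controls
`u[0], …, u[n-1]`. -/
abbrev Information (d n : ℕ) : Type :=
  (Fin (n + 1) → EuclideanSpace ℝ (Fin d)) × (Fin (n + 1) → EuclideanSpace ℝ (Fin d)) ×
    (Fin n → ℝ)

/-- `X` and `u` are the states and the controls of the system `X[n+1] = A X[n] + B[n] u[n]`
when it is started at `x₀` and controlled by the strategy `g`. -/
structure IsClosedLoop {Ω : Type*} {d : ℕ} (A : Matrix (Fin d) (Fin d) ℝ)
    (B : ℕ → Ω → EuclideanSpace ℝ (Fin d)) (g : ∀ n : ℕ, Information d n → ℝ)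
    (x₀ : EuclideanSpace ℝ (Fin d))
    (X : ℕ → Ω → EuclideanSpace ℝ (Fin d)) (u : ℕ → Ω → ℝ) : Prop where
  init : ∀ ω, X 0 ω = x₀
  step : ∀ n ω, X (n + 1) ω = WithLp.toLp 2 (A *ᵥ (X n ω).ofLp) + u n ω • B n ω
  control : ∀ n ω, u n ω =
    g n (fun i => B (i : ℕ) ω, fun i => X (i : ℕ) ω, fun i => u (i : ℕ) ω)

/-- Second-moment stabilizability of the system `X[n+1] = A X[n] + B[n] u[n]`: from every fixed
initial state, some causal (measurable) control strategy achieves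
`limsup E[X[n]ᵀ X[n]] < ∞`. The expectation is taken in `[0, ∞]`. -/
def SecondMomentStabilizable {Ω : Type*} [MeasurableSpace Ω] (P : Measure Ω) {d : ℕ}
    (A : Matrix (Fin d) (Fin d) ℝ) (B : ℕ → Ω → EuclideanSpace ℝ (Fin d)) : Prop :=
  ∀ x₀ : EuclideanSpace ℝ (Fin d),
    ∃ g : ∀ n : ℕ, Information d n → ℝ, (∀ n, Measurable (g n)) ∧
      ∃ (X : ℕ → Ω → EuclideanSpace ℝ (Fin d)) (u : ℕ → Ω → ℝ),
        IsClosedLoop A B g x₀ X u ∧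
          limsup (fun n => ∫⁻ ω, ‖X n ω‖ₑ ^ 2 ∂P) atTop < ∞

/-- The number `m` of the eigenvalues `lam i` that are greater than `1` in magnitude. -/
noncomputable def numUnstable {d : ℕ} (lam : Fin d → ℝ) : ℕ :=
  (Finset.univ.filter fun i => 1 < |lam i|).card

/-- The threshold quantity `r = (m - 1) / ∑_{|lam i| > 1} (lam i)⁻²`. When no `lam i` is greater
than `1` in magnitude, the sum is empty and `r = 0`. -/
noncomputable def stabilityRatio {d : ℕ} (lam : Fin d → ℝ) : ℝ :=
  ((numUnstable lam : ℝ) - 1) /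
    ∑ i ∈ Finset.univ.filter (fun i => 1 < |lam i|), ((lam i) ^ 2)⁻¹

/-! Measure the state by V(x) = ∑ qᵢ xᵢ² with weights q ≥ 0. Given X[n] and B[n], minimizing
V(X[n+1]) over the control is a least-squares problem with value `minCost`. Averaging over the
direction kills the cross terms by sign symmetry, so the mean minimum is again diagonal: ∑ qᵢ (1 -
sᵢ) λᵢ² xᵢ², where sᵢ = E[qᵢ bᵢ² / ∑ qⱼ bⱼ²] are shares with total 1 (`lintegral_minCost`).

Mode i does not grow once sᵢ reaches its `demand`, which is 1 - λᵢ⁻² for an unstable mode and 0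
otherwise. Total demand is m - ∑ λᵢ⁻², so r < 1 puts it below 1 and r > 1 puts it above 1. By
`exists_meanShare_eq` any point of the simplex can be prescribed as the shares. If total demand is
below 1, positive weights serve every mode and the greedy control keeps E[V] bounded. If it exceeds
1, shares proportional to demand leave every weighted mode short, and E[V] grows geometrically under
any strategy. -/

/-! ### Mean shares in a random weighted sum, and their surjectivity onto the simplex -/

section Shares

variable {ι S : Type*} [Fintype ι] [MeasurableSpace S]

/-- The mean share of the `i`-th term in the random weighted sum `∑ j, q j * c j`. -/
noncomputable def meanShare (μ : Measure S) (c : S → ι → ℝ) (q : ι → ℝ) (i : ι) : ℝ :=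
  ∫ s, q i * c s i / ∑ j, q j * c s j ∂μ

lemma weightedSum_pos {q c : ι → ℝ} (hq : ∀ i, 0 ≤ q i) (hs : 0 < ∑ i, q i)
    (hc : ∀ i, 0 < c i) : 0 < ∑ j, q j * c j := by
  obtain ⟨i, -, hi⟩ := Finset.exists_lt_of_sum_lt (s := Finset.univ) (f := fun _ : ι => (0 : ℝ))
    (g := q) (by simpa using hs)
  exact Finset.sum_pos' (fun j _ => mul_nonneg (hq j) (hc j).le)
    ⟨i, Finset.mem_univ i, mul_pos hi (hc i)⟩

lemma share_mem_Icc {q c : ι → ℝ} (hq : ∀ i, 0 ≤ q i) (hc : ∀ i, 0 ≤ c i) (i : ι) :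
    q i * c i / ∑ j, q j * c j ∈ Set.Icc (0 : ℝ) 1 := by
  have h0 : ∀ j, 0 ≤ q j * c j := fun j => mul_nonneg (hq j) (hc j)
  refine ⟨div_nonneg (h0 i) (Finset.sum_nonneg fun j _ => h0 j), ?_⟩
  exact div_le_one_of_le₀ (Finset.single_le_sum (f := fun j => q j * c j) (fun j _ => h0 j)
    (Finset.mem_univ i)) (Finset.sum_nonneg fun j _ => h0 j)

variable {μ : Measure S} {c : S → ι → ℝ}

lemma meanShare_smul {t : ℝ} (ht : t ≠ 0) (q : ι → ℝ) (i : ι) :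
    meanShare μ c (t • q) i = meanShare μ c q i := by
  unfold meanShare
  congr 1
  ext s
  simp only [Pi.smul_apply, smul_eq_mul, mul_assoc, ← Finset.mul_sum]
  exact mul_div_mul_left _ _ ht

lemma meanShare_eq_zero {q : ι → ℝ} {i : ι} (hi : q i = 0) : meanShare μ c q i = 0 := by
  simp [meanShare, hi]

variable [IsProbabilityMeasure μ]

lemma integral_pos_of_ae_pos {f : S → ℝ} (hf : Integrable f μ) (h : ∀ᵐ s ∂μ, 0 < f s) :
    0 < ∫ s, f s ∂μ := by
  rw [integral_pos_iff_support_of_nonneg_ae (h.mono fun s hs => hs.le) hf]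
  have : Function.support f =ᵐ[μ] Set.univ := by
    rw [eventuallyEq_univ]
    filter_upwards [h] with s hs
    exact hs.ne'
  rw [measure_congr this]
  simp

lemma measurable_share (hcm : ∀ i, Measurable fun s => c s i) (q : ι → ℝ) (i : ι) :
    Measurable fun s => q i * c s i / ∑ j, q j * c s j := by
  fun_prop

lemma integrable_share (hcm : ∀ i, Measurable fun s => c s i)
    (hc : ∀ᵐ s ∂μ, ∀ i, 0 < c s i) {q : ι → ℝ} (hq : ∀ i, 0 ≤ q i) (i : ι) :
    Integrable (fun s => q i * c s i / ∑ j, q j * c s j) μ := by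
  refine Integrable.of_bound (measurable_share hcm q i).aestronglyMeasurable 1 ?_
  filter_upwards [hc] with s hs
  have := share_mem_Icc hq (fun j => (hs j).le) i
  rw [Real.norm_eq_abs, abs_of_nonneg this.1]
  exact this.2

lemma sum_meanShare (hcm : ∀ i, Measurable fun s => c s i)
    (hc : ∀ᵐ s ∂μ, ∀ i, 0 < c s i) {q : ι → ℝ} (hq : ∀ i, 0 ≤ q i) (hs : 0 < ∑ i, q i) :
    ∑ i, meanShare μ c q i = 1 := by
  unfold meanShare
  rw [← integral_finsetSum _ fun i _ => integrable_share hcm hc hq i]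
  have : ∫ s, ∑ i, q i * c s i / ∑ j, q j * c s j ∂μ = ∫ _, (1 : ℝ) ∂μ := by
    refine integral_congr_ae ?_
    filter_upwards [hc] with s hs'
    rw [← Finset.sum_div]
    exact div_self (weightedSum_pos hq hs hs').ne'
  simpa using this

/-- The numerator of the i-th share is unchanged while the denominator strictly increases almost
surely. -/
lemma meanShare_lt_meanShare (hcm : ∀ i, Measurable fun s => c s i)
    (hc : ∀ᵐ s ∂μ, ∀ i, 0 < c s i) {q q' : ι → ℝ} (hq : ∀ i, 0 ≤ q i) (hqq : ∀ i, q i ≤ q' i)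
    {i j : ι} (hi : q' i = q i) (hpos : 0 < q i) (hj : q j < q' j) :
    meanShare μ c q' i < meanShare μ c q i := by
  have hs : 0 < ∑ i, q i :=
    Finset.sum_pos' (fun k _ => hq k) ⟨i, Finset.mem_univ i, hpos⟩
  have key : ∀ᵐ s ∂μ, q' i * c s i / ∑ j, q' j * c s j < q i * c s i / ∑ j, q j * c s j := by
    filter_upwards [hc] with s hcs
    rw [hi]
    refine div_lt_div_of_pos_left (mul_pos hpos (hcs i)) (weightedSum_pos hq hs hcs) ?_
    exact Finset.sum_lt_sum (fun k _ => mul_le_mul_of_nonneg_right (hqq k) (hcs k).le)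
      ⟨j, Finset.mem_univ j, mul_lt_mul_of_pos_right hj (hcs j)⟩
  have hint := integrable_share hcm hc hq i
  have hint' := integrable_share hcm hc (fun k => (hq k).trans (hqq k)) i
  rw [← sub_pos]
  unfold meanShare
  rw [← integral_sub hint hint']
  exact integral_pos_of_ae_pos (hint.sub hint') (key.mono fun s hs => sub_pos.2 hs)

lemma meanShare_pos (hcm : ∀ i, Measurable fun s => c s i)
    (hc : ∀ᵐ s ∂μ, ∀ i, 0 < c s i) {q : ι → ℝ} (hq : ∀ i, 0 ≤ q i) {i : ι} (hi : 0 < q i) :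
    0 < meanShare μ c q i := by
  have hs : 0 < ∑ i, q i :=
    Finset.sum_pos' (fun k _ => hq k) ⟨i, Finset.mem_univ i, hi⟩
  refine integral_pos_of_ae_pos (integrable_share hcm hc hq i) ?_
  filter_upwards [hc] with s hcs
  exact div_pos (mul_pos hi (hcs i)) (weightedSum_pos hq hs hcs)

lemma continuousOn_meanShare (hcm : ∀ i, Measurable fun s => c s i)
    (hc : ∀ᵐ s ∂μ, ∀ i, 0 < c s i) (i : ι) :
    ContinuousOn (fun q => meanShare μ c q i) {q | (∀ i, 0 ≤ q i) ∧ 0 < ∑ i, q i} := by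
  intro q hq
  refine continuousWithinAt_of_dominated (bound := fun _ => 1) ?_ ?_ (integrable_const _) ?_
  · exact Eventually.of_forall fun q => (measurable_share hcm q i).aestronglyMeasurable
  · filter_upwards [self_mem_nhdsWithin] with q' hq'
    filter_upwards [hc] with s hs
    have := share_mem_Icc hq'.1 (fun j => (hs j).le) i
    rw [Real.norm_eq_abs, abs_of_nonneg this.1]
    exact this.2
  · filter_upwards [hc] with s hs
    refine ContinuousAt.continuousWithinAt ?_
    have h1 : Continuous fun q : ι → ℝ => q i * c s i := by fun_prop
    have h2 : Continuous fun q : ι → ℝ => ∑ j, q j * c s j :=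
      continuous_finsetSum _ fun j _ => (continuous_apply j).mul continuous_const
    refine h1.continuousAt.div h2.continuousAt ?_
    exact (weightedSum_pos hq.1 hq.2 hs).ne'

/-- Every point of the simplex is the vector of mean shares of suitable weights. -/
theorem exists_meanShare_eq (hcm : ∀ i, Measurable fun s => c s i)
    (hc : ∀ᵐ s ∂μ, ∀ i, 0 < c s i) {p : ι → ℝ} (hp : p ∈ stdSimplex ℝ ι) :
    ∃ q ∈ stdSimplex ℝ ι, ∀ i, meanShare μ c q i = p i := by
  classical
  have hne : (Finset.univ : Finset ι).Nonempty := by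
    by_contra h
    have := hp.2
    rw [Finset.not_nonempty_iff_eq_empty.1 h] at this
    simp at this
  have hsub : stdSimplex ℝ ι ⊆ {q | (∀ i, 0 ≤ q i) ∧ 0 < ∑ i, q i} :=
    fun q hq => ⟨hq.1, by rw [hq.2]; exact one_pos⟩
  -- Minimize the largest excess of a share over its target. The excesses sum to zero, so a
  -- nonpositive maximum forces them all to vanish.
  set G : (ι → ℝ) → ℝ := fun q => Finset.univ.sup' hne fun i => meanShare μ c q i - p i with hG
  have hGc : ContinuousOn G (stdSimplex ℝ ι) :=
    ContinuousOn.finset_sup'_apply hne fun i _ =>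
      ((continuousOn_meanShare hcm hc i).mono hsub).sub continuousOn_const
  obtain ⟨q, hq, hmin⟩ := (isCompact_stdSimplex ℝ ι).exists_isMinOn ⟨p, hp⟩ hGc
  have hle : ∀ i, meanShare μ c q i - p i ≤ G q := fun i =>
    Finset.le_sup' (fun i => meanShare μ c q i - p i) (Finset.mem_univ i)
  have hsum : ∑ i, (meanShare μ c q i - p i) = 0 := by
    rw [Finset.sum_sub_distrib, sum_meanShare hcm hc hq.1 (hsub hq).2, hp.2, sub_self]
  have hG0 : G q ≤ 0 := by
    by_contra! hpos
    obtain ⟨j, hj⟩ : ∃ j, meanShare μ c q j - p j < G q := by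
      by_contra! h
      have : 0 < ∑ i, (meanShare μ c q i - p i) :=
        Finset.sum_pos (fun i _ => hpos.trans_le (h i)) hne
      exact this.ne' hsum
    -- If the maximum is positive, slightly raising the weights of all indices below it should lower
    -- it, contradicting minimality.
    set e : ι → ℝ := fun i => if meanShare μ c q i - p i < G q then 1 else 0 with he
    have he0 : ∀ i, 0 ≤ e i := fun i => by simp only [he]; split_ifs <;> norm_num
    have hej : e j = 1 := by simp [he, hj]
    have hK : ∀ ε : ℝ, 0 ≤ ε → q + ε • e ∈ {q : ι → ℝ | (∀ i, 0 ≤ q i) ∧ 0 < ∑ i, q i} := by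
      intro ε hε
      have h1 : ∀ i, q i ≤ (q + ε • e) i := fun i => by
        simpa using mul_nonneg hε (he0 i)
      exact ⟨fun i => (hq.1 i).trans (h1 i),
        (hsub hq).2.trans_le (Finset.sum_le_sum fun i _ => h1 i)⟩
    have hsmall : ∀ i, ∀ᶠ ε in nhdsWithin (0 : ℝ) (Set.Ioi 0),
        meanShare μ c (q + ε • e) i - p i < G q := by
      intro i
      by_cases hi : meanShare μ c q i - p i < G q
      -- Indices below the maximum stay below it for small ε, by continuity.
      · have ht : Tendsto (fun ε : ℝ => q + ε • e) (nhdsWithin 0 (Set.Ioi 0))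
            (nhdsWithin q {q | (∀ i, 0 ≤ q i) ∧ 0 < ∑ i, q i}) := by
          refine tendsto_nhdsWithin_iff.2 ⟨?_, ?_⟩
          · have : Continuous fun ε : ℝ => q + ε • e := by fun_prop
            simpa using (this.tendsto 0).mono_left nhdsWithin_le_nhds
          · filter_upwards [self_mem_nhdsWithin] with ε hε
            exact hK ε (le_of_lt hε)
        have := ((continuousOn_meanShare hcm hc i q (hsub hq)).tendsto.comp ht).sub_const (p i)
        exact this.eventually_lt_const hi
      -- An index attaining the maximum has share above `p i ≥ 0`, hence positive weight. Its weight
      -- is fixed while that of `j` grows, so its share drops.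
      · filter_upwards [self_mem_nhdsWithin] with ε hε
        have hε' : (0 : ℝ) < ε := hε
        have hei : e i = 0 := by simp [he, hi]
        have hqi : 0 < q i := by
          refine lt_of_le_of_ne (hq.1 i) fun h => hi ?_
          rw [meanShare_eq_zero h.symm]
          linarith [hp.1 i]
        have := meanShare_lt_meanShare hcm hc hq.1 (q' := q + ε • e) (i := i) (j := j)
          (fun k => by simpa using mul_nonneg hε'.le (he0 k)) (by simp [hei]) hqi
          (by simp [hej, hε'])
        linarith [hle i]
    obtain ⟨ε, hε, hε0⟩ := ((eventually_all.2 hsmall).and self_mem_nhdsWithin).exists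
    have hq' := hK ε (le_of_lt hε0)
    -- Shares are scale invariant, so the perturbed weights may be rescaled back into the simplex.
    set T := ∑ i, (q + ε • e) i with hT
    have hmem : T⁻¹ • (q + ε • e) ∈ stdSimplex ℝ ι := by
      refine ⟨fun i => mul_nonneg (inv_nonneg.2 hq'.2.le) (hq'.1 i), ?_⟩
      change ∑ i, T⁻¹ * (q + ε • e) i = 1
      rw [← Finset.mul_sum]
      exact inv_mul_cancel₀ hq'.2.ne'
    have hlt : G (T⁻¹ • (q + ε • e)) < G q := by
      refine (Finset.sup'_lt_iff hne).2 fun i _ => ?_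
      rw [meanShare_smul (inv_ne_zero hq'.2.ne')]
      exact hε i
    exact hlt.not_ge (hmin hmem)
  refine ⟨q, hq, fun i => ?_⟩
  have := (Finset.sum_eq_zero_iff_of_nonpos fun i _ => (hle i).trans hG0).1 hsum i
    (Finset.mem_univ i)
  linarith

end Shares

/-! ### Null sets and sign symmetry of the uniform law on the sphere -/

section Sphere

variable {d : ℕ}

lemma measurable_normalize : Measurable fun x : Fin d → ℝ =>
    ‖(WithLp.toLp 2 x : EuclideanSpace ℝ (Fin d))‖⁻¹ •
      (WithLp.toLp 2 x : EuclideanSpace ℝ (Fin d)) := by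
  fun_prop

instance isProbabilityMeasure_uniformSphere : IsProbabilityMeasure (uniformSphere d) :=
  Measure.isProbabilityMeasure_map measurable_normalize.aemeasurable

lemma uniformSphere_ae_ne_zero : ∀ᵐ b ∂uniformSphere d, ∀ i, b i ≠ 0 := by
  have hae : ∀ᵐ x ∂(Measure.pi fun _ : Fin d => gaussianReal 0 1), ∀ i, x i ≠ 0 := by
    refine ae_all_iff.2 fun i => ?_
    have : NullSingletonClass (gaussianReal 0 1) := nullSingletonClass_gaussianReal one_ne_zero
    exact (Measure.quasiMeasurePreserving_eval (fun _ : Fin d => gaussianReal 0 1) i).ae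
      (Measure.ae_ne (gaussianReal 0 1) 0)
  unfold uniformSphere
  rw [ae_map_iff measurable_normalize.aemeasurable]
  · filter_upwards [hae] with x hx i
    have hne : (WithLp.toLp 2 x : EuclideanSpace ℝ (Fin d)) ≠ 0 := fun h => hx i (by
      have := congrArg (fun v : EuclideanSpace ℝ (Fin d) => v i) h
      simpa using this)
    simp [hx i, hne]
  · simp only [Set.ofPred_forall]
    refine MeasurableSet.iInter fun i => ?_
    exact (measurableSet_eq_fun (by fun_prop) measurable_const).compl

/-- The uniform distribution on the sphere is invariant under changing the sign of a coordinate. -/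
lemma integral_uniformSphere_eq_zero_of_odd (i : Fin d) {f : EuclideanSpace ℝ (Fin d) → ℝ}
    (hf : Measurable f)
    (hodd : ∀ b b' : EuclideanSpace ℝ (Fin d), b' i = -b i → (∀ j, j ≠ i → b' j = b j) →
      f b' = -f b) :
    ∫ b, f b ∂uniformSphere d = 0 := by
  unfold uniformSphere
  rw [integral_map measurable_normalize.aemeasurable hf.aestronglyMeasurable]
  set h : (Fin d → ℝ) → ℝ := fun x => f (‖(WithLp.toLp 2 x : EuclideanSpace ℝ (Fin d))‖⁻¹ •
      (WithLp.toLp 2 x : EuclideanSpace ℝ (Fin d))) with hh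
  -- The flip preserves the Gaussian product law, and it preserves the norm, so it commutes with
  -- normalization.
  have hflip : MeasurePreserving (fun (x : Fin d → ℝ) j => (if j = i then fun t : ℝ => -t else id)
      (x j)) (Measure.pi fun _ : Fin d => gaussianReal 0 1)
      (Measure.pi fun _ : Fin d => gaussianReal 0 1) := by
    refine measurePreserving_pi _ _ fun j => ?_
    split_ifs
    · exact ⟨measurable_neg, by simpa using gaussianReal_map_neg (μ := 0) (v := 1)⟩
    · exact MeasurePreserving.id _
  have hneg : ∀ x : Fin d → ℝ,
      h (fun j => (if j = i then fun t : ℝ => -t else id) (x j)) = -h x := by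
    intro x
    have hn : ‖(WithLp.toLp 2 (fun j => (if j = i then fun t : ℝ => -t else id) (x j)) :
        EuclideanSpace ℝ (Fin d))‖ = ‖(WithLp.toLp 2 x : EuclideanSpace ℝ (Fin d))‖ := by
      rw [EuclideanSpace.norm_eq, EuclideanSpace.norm_eq]
      congr 1
      refine Finset.sum_congr rfl fun j _ => ?_
      by_cases hj : j = i <;> simp [hj]
    simp only [hh]
    rw [hn]
    refine hodd _ _ ?_ fun j hj => ?_
    · simp
    · simp [hj]
  have hm : Measurable h := hf.comp measurable_normalize
  have h1 := integral_map (μ := Measure.pi fun _ : Fin d => gaussianReal 0 1)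
    hflip.measurable.aemeasurable (f := h) hm.aestronglyMeasurable
  rw [hflip.map_eq] at h1
  simp only [hneg, integral_neg] at h1
  linarith

end Sphere

/-! ### The optimal one-step cost and its mean over the direction -/

section OneStep

variable {d : ℕ}

/-- The minimum over `u` of `∑ i, q i * (y i + u * b i) ^ 2`. -/
noncomputable def minCost (q y b : Fin d → ℝ) : ℝ :=
  ∑ i, q i * y i ^ 2 - (∑ i, q i * b i * y i) ^ 2 / ∑ i, q i * b i ^ 2

lemma cost_eq (q y b : Fin d → ℝ) (u : ℝ) :
    ∑ i, q i * (y i + u * b i) ^ 2 =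
      ∑ i, q i * y i ^ 2 + 2 * u * (∑ i, q i * b i * y i) + u ^ 2 * ∑ i, q i * b i ^ 2 := by
  rw [Finset.mul_sum, Finset.mul_sum, ← Finset.sum_add_distrib, ← Finset.sum_add_distrib]
  exact Finset.sum_congr rfl fun i _ => by ring

lemma sum_mul_eq_zero {q b : Fin d → ℝ} (hq : ∀ i, 0 ≤ q i) (h : ∑ i, q i * b i ^ 2 = 0)
    (y : Fin d → ℝ) : ∑ i, q i * b i * y i = 0 := by
  refine Finset.sum_eq_zero fun i hi => ?_
  have := (Finset.sum_eq_zero_iff_of_nonneg fun i _ => mul_nonneg (hq i) (sq_nonneg (b i))).1 h i hi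
  rcases mul_eq_zero.1 this with h | h
  · simp [h]
  · simp [pow_eq_zero_iff two_ne_zero |>.1 h]

lemma minCost_le {q : Fin d → ℝ} (hq : ∀ i, 0 ≤ q i) (y b : Fin d → ℝ) (u : ℝ) :
    minCost q y b ≤ ∑ i, q i * (y i + u * b i) ^ 2 := by
  rw [cost_eq, minCost]
  set W := ∑ i, q i * b i ^ 2 with hW
  set N := ∑ i, q i * b i * y i with hN
  have hW0 : 0 ≤ W := Finset.sum_nonneg fun i _ => mul_nonneg (hq i) (sq_nonneg (b i))
  -- If `W = 0` the linear term vanishes too, and the quotient is 0 by convention; otherwise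
  -- complete the square.
  rcases hW0.eq_or_lt with h | h
  · have : N = 0 := sum_mul_eq_zero hq h.symm y
    simp [this, ← h]
  · have : 2 * u * N + u ^ 2 * W + N ^ 2 / W = (N + u * W) ^ 2 / W := by
      field_simp
      ring
    have h2 : 0 ≤ (N + u * W) ^ 2 / W := by positivity
    linarith

lemma minCost_eq {q : Fin d → ℝ} (hq : ∀ i, 0 ≤ q i) (y b : Fin d → ℝ) :
    ∑ i, q i * (y i + -(∑ i, q i * b i * y i) / (∑ i, q i * b i ^ 2) * b i) ^ 2 =
      minCost q y b := by
  rw [cost_eq, minCost]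
  by_cases h : ∑ i, q i * b i ^ 2 = 0
  · simp [sum_mul_eq_zero hq h y]
  · field_simp
    ring

lemma minCost_nonneg {q : Fin d → ℝ} (hq : ∀ i, 0 ≤ q i) (y b : Fin d → ℝ) :
    0 ≤ minCost q y b := by
  rw [← minCost_eq hq]
  exact Finset.sum_nonneg fun i _ => mul_nonneg (hq i) (sq_nonneg _)

/-- With W the denominator, |bᵢ bⱼ| ≤ bᵢ² + bⱼ² and qₖ bₖ² ≤ W give |qᵢ bᵢ qⱼ bⱼ| ≤ (qᵢ + qⱼ) W. The
bound serves integrability. -/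
lemma abs_cross_le {q : Fin d → ℝ} (hq : ∀ i, 0 ≤ q i) (b : Fin d → ℝ) (i j : Fin d) :
    |q i * b i * (q j * b j) / ∑ k, q k * b k ^ 2| ≤ q i + q j := by
  set W := ∑ i, q i * b i ^ 2 with hW
  have hW0 : 0 ≤ W := Finset.sum_nonneg fun i _ => mul_nonneg (hq i) (sq_nonneg (b i))
  have hle : ∀ k, q k * b k ^ 2 ≤ W := fun k =>
    Finset.single_le_sum (f := fun k => q k * b k ^ 2)
      (fun i _ => mul_nonneg (hq i) (sq_nonneg (b i))) (Finset.mem_univ k)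
  rw [abs_div, abs_of_nonneg hW0]
  refine div_le_of_le_mul₀ hW0 (add_nonneg (hq i) (hq j)) ?_
  have h1 := mul_le_mul_of_nonneg_left (hle i) (hq j)
  have h2 := mul_le_mul_of_nonneg_left (hle j) (hq i)
  have h3 := mul_nonneg (hq i) (hq j)
  rw [abs_le]
  constructor
  · nlinarith [mul_nonneg h3 (sq_nonneg (b i + b j)), mul_nonneg h3 (sq_nonneg (b i)),
      mul_nonneg h3 (sq_nonneg (b j))]
  · nlinarith [mul_nonneg h3 (sq_nonneg (b i - b j)), mul_nonneg h3 (sq_nonneg (b i)),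
      mul_nonneg h3 (sq_nonneg (b j))]

lemma integrable_cross {q : Fin d → ℝ} (hq : ∀ i, 0 ≤ q i) (i j : Fin d) :
    Integrable (fun b : EuclideanSpace ℝ (Fin d) =>
      q i * b i * (q j * b j) / ∑ k, q k * b k ^ 2) (uniformSphere d) := by
  refine Integrable.of_bound (Measurable.aestronglyMeasurable (by fun_prop)) (q i + q j) ?_
  exact Eventually.of_forall fun b => abs_cross_le hq _ i j

/-- For i ≠ j the integrand is odd in bᵢ. -/
lemma integral_cross {q : Fin d → ℝ} (i j : Fin d) :
    ∫ b : EuclideanSpace ℝ (Fin d), q i * b i * (q j * b j) / ∑ k, q k * b k ^ 2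
      ∂uniformSphere d =
      if i = j then q i * meanShare (uniformSphere d)
        (fun (b : EuclideanSpace ℝ (Fin d)) i => b i ^ 2) q i else 0 := by
  split_ifs with h
  · subst h
    rw [meanShare, ← integral_const_mul]
    congr 1
    ext b
    ring
  · refine integral_uniformSphere_eq_zero_of_odd i (by fun_prop) fun b b' hi hne => ?_
    have hW : ∑ k, q k * b' k ^ 2 = ∑ k, q k * b k ^ 2 := by
      refine Finset.sum_congr rfl fun k _ => ?_
      by_cases hk : k = i
      · subst hk; rw [hi]; ring
      · rw [hne k hk]
    rw [hW, hi, hne j (Ne.symm h)]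
    ring

lemma sq_sum_div (q y b : Fin d → ℝ) :
    (∑ i, q i * b i * y i) ^ 2 / ∑ i, q i * b i ^ 2 =
      ∑ i, ∑ j, y i * y j * (q i * b i * (q j * b j) / ∑ k, q k * b k ^ 2) := by
  rw [sq, Finset.sum_mul_sum, Finset.sum_div]
  refine Finset.sum_congr rfl fun i _ => ?_
  rw [Finset.sum_div]
  exact Finset.sum_congr rfl fun j _ => by ring

lemma lintegral_minCost {q : Fin d → ℝ} (hq : ∀ i, 0 ≤ q i) (y : Fin d → ℝ) :
    ∫⁻ b : EuclideanSpace ℝ (Fin d), ENNReal.ofReal (minCost q y b.ofLp) ∂uniformSphere d =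
      ENNReal.ofReal (∑ i, q i * (1 - meanShare (uniformSphere d)
        (fun (b : EuclideanSpace ℝ (Fin d)) i => b i ^ 2) q i) * y i ^ 2) := by
  have hint : Integrable (fun b : EuclideanSpace ℝ (Fin d) =>
      ∑ i, ∑ j, y i * y j * (q i * b i * (q j * b j) / ∑ k, q k * b k ^ 2)) (uniformSphere d) :=
    integrable_finsetSum _ fun i _ => integrable_finsetSum _ fun j _ =>
      (integrable_cross hq i j).const_mul _
  have hint' : Integrable (fun b : EuclideanSpace ℝ (Fin d) => minCost q y b.ofLp)
      (uniformSphere d) := by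
    simp only [minCost, sq_sum_div]
    exact (integrable_const _).sub hint
  rw [← ofReal_integral_eq_lintegral_ofReal hint'
    (Eventually.of_forall fun b => minCost_nonneg hq _ _)]
  congr 1
  simp only [minCost, sq_sum_div]
  rw [integral_sub (integrable_const _) hint, integral_finsetSum _ fun i _ =>
    integrable_finsetSum _ fun j _ => (integrable_cross hq i j).const_mul _]
  simp only [integral_const, probReal_univ, one_smul]
  rw [← Finset.sum_sub_distrib]
  refine Finset.sum_congr rfl fun i _ => ?_
  rw [integral_finsetSum _ fun j _ => (integrable_cross hq i j).const_mul _]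
  simp only [integral_const_mul, integral_cross, mul_ite, mul_zero, Finset.sum_ite_eq,
    Finset.mem_univ, if_true]
  ring

end OneStep

/-! ### Causality, independence and the evolution of the weighted cost -/

section ClosedLoop

variable {Ω : Type*} {d : ℕ}
  {B : ℕ → Ω → EuclideanSpace ℝ (Fin d)}

/-- The events determined by the directions `B 0, …, B (n - 1)`. -/
@[reducible] def pastSigma (B : ℕ → Ω → EuclideanSpace ℝ (Fin d)) (n : ℕ) : MeasurableSpace Ω :=
  ⨆ k ∈ Set.Iio n, MeasurableSpace.comap (B k) inferInstance

lemma pastSigma_mono {m n : ℕ} (h : m ≤ n) : pastSigma B m ≤ pastSigma B n :=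
  biSup_mono fun _ hk => lt_of_lt_of_le hk h

lemma measurable_direction {k n : ℕ} (h : k < n) : Measurable[pastSigma B n] (B k) :=
  (comap_measurable (B k)).mono
    (le_biSup (fun k => MeasurableSpace.comap (B k) inferInstance) (Set.mem_Iio.2 h)) le_rfl

variable {A : Matrix (Fin d) (Fin d) ℝ} {g : ∀ n : ℕ, Information d n → ℝ}
  {x₀ : EuclideanSpace ℝ (Fin d)} {X : ℕ → Ω → EuclideanSpace ℝ (Fin d)} {u : ℕ → Ω → ℝ}

lemma measurable_step : Measurable fun z : EuclideanSpace ℝ (Fin d) × ℝ × EuclideanSpace ℝ (Fin d) =>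
    WithLp.toLp 2 (A *ᵥ z.1.ofLp) + z.2.1 • z.2.2 := by
  have : Continuous fun v : Fin d → ℝ => A *ᵥ v := by fun_prop
  have h2 : Measurable fun z : EuclideanSpace ℝ (Fin d) × ℝ × EuclideanSpace ℝ (Fin d) =>
      A *ᵥ z.1.ofLp := this.measurable.comp (by fun_prop)
  fun_prop

/-- The indices differ by one because the control at time `n` sees `B n`, whereas the state does not
depend on it yet. -/
lemma IsClosedLoop.measurable_pastSigma (h : IsClosedLoop A B g x₀ X u)
    (hg : ∀ n, Measurable (g n)) (n : ℕ) :
    Measurable[pastSigma B n] (X n) ∧ Measurable[pastSigma B (n + 1)] (u n) := by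
  induction n using Nat.strong_induction_on with
  | _ n ih =>
    have hX : Measurable[pastSigma B n] (X n) := by
      cases n with
      | zero =>
        have : X 0 = fun _ => x₀ := funext h.init
        rw [this]
        exact measurable_const
      | succ k =>
        have : X (k + 1) = (fun z : EuclideanSpace ℝ (Fin d) × ℝ × EuclideanSpace ℝ (Fin d) =>
            WithLp.toLp 2 (A *ᵥ z.1.ofLp) + z.2.1 • z.2.2) ∘ fun ω => (X k ω, u k ω, B k ω) :=
          funext (h.step k)
        rw [this]
        have hk := ih k k.lt_succ_self
        exact measurable_step.comp ((hk.1.mono (pastSigma_mono k.le_succ) le_rfl).prodMk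
          (hk.2.prodMk (measurable_direction k.lt_succ_self)))
    refine ⟨hX, ?_⟩
    have : u n = g n ∘ fun ω => (fun i : Fin (n + 1) => B (i : ℕ) ω,
        fun i : Fin (n + 1) => X (i : ℕ) ω, fun i : Fin n => u (i : ℕ) ω) :=
      funext (h.control n)
    rw [this]
    let _ : MeasurableSpace Ω := pastSigma B (n + 1)
    refine (hg n).comp (Measurable.prodMk ?_ (Measurable.prodMk ?_ ?_))
    · exact measurable_pi_lambda _ fun i => measurable_direction i.2
    · refine measurable_pi_lambda _ fun i => ?_
      rcases (Nat.lt_succ_iff.1 i.2).eq_or_lt with hi | hi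
      · rw [hi]
        exact hX.mono (pastSigma_mono n.le_succ) le_rfl
      · exact (ih i hi).1.mono (pastSigma_mono (hi.le.trans n.le_succ)) le_rfl
    · exact measurable_pi_lambda _ fun i =>
        (ih i i.2).2.mono (pastSigma_mono (i.2.trans n.lt_succ_self)) le_rfl

variable {lam : Fin d → ℝ}

lemma IsClosedLoop.step_apply (h : IsClosedLoop (Matrix.diagonal lam) B g x₀ X u)
    (n : ℕ) (ω : Ω) (i : Fin d) : X (n + 1) ω i = lam i * X n ω i + u n ω * B n ω i := by
  rw [h.step]
  simp [Matrix.mulVec_diagonal]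

/-- The memoryless control that minimizes the weighted cost of the next state. -/
noncomputable def greedyControl (q lam : Fin d → ℝ) (n : ℕ) (I : Information d n) : ℝ :=
  -(∑ i, q i * I.1 (Fin.last n) i * (lam i * I.2.1 (Fin.last n) i)) /
    ∑ i, q i * I.1 (Fin.last n) i ^ 2

lemma measurable_greedyControl (q lam : Fin d → ℝ) (n : ℕ) :
    Measurable (greedyControl q lam n) := by
  have h1 : ∀ i, Measurable fun I : Information d n => I.1 (Fin.last n) i := fun i => by fun_prop
  have h2 : ∀ i, Measurable fun I : Information d n => I.2.1 (Fin.last n) i :=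
    fun i => by fun_prop
  unfold greedyControl
  fun_prop

/-- The states reached under a memoryless feedback. -/
noncomputable def feedbackState (A : Matrix (Fin d) (Fin d) ℝ)
    (B : ℕ → Ω → EuclideanSpace ℝ (Fin d))
    (k : EuclideanSpace ℝ (Fin d) → EuclideanSpace ℝ (Fin d) → ℝ)
    (x₀ : EuclideanSpace ℝ (Fin d)) : ℕ → Ω → EuclideanSpace ℝ (Fin d)
  | 0, _ => x₀
  | n + 1, ω => WithLp.toLp 2 (A *ᵥ (feedbackState A B k x₀ n ω).ofLp) +
      k (B n ω) (feedbackState A B k x₀ n ω) • B n ω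

lemma exists_isClosedLoop_greedyControl (q lam : Fin d → ℝ) (x₀ : EuclideanSpace ℝ (Fin d)) :
    ∃ (X : ℕ → Ω → EuclideanSpace ℝ (Fin d)) (u : ℕ → Ω → ℝ),
      IsClosedLoop (Matrix.diagonal lam) B (greedyControl q lam) x₀ X u ∧
      ∀ n ω, u n ω =
        -(∑ i, q i * B n ω i * (lam i * X n ω i)) / ∑ i, q i * B n ω i ^ 2 := by
  set k : EuclideanSpace ℝ (Fin d) → EuclideanSpace ℝ (Fin d) → ℝ := fun b x =>
    -(∑ i, q i * b i * (lam i * x i)) / ∑ i, q i * b i ^ 2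
  refine ⟨feedbackState (Matrix.diagonal lam) B k x₀,
    fun n ω => k (B n ω) (feedbackState (Matrix.diagonal lam) B k x₀ n ω),
    ⟨fun ω => rfl, fun n ω => rfl, fun n ω => ?_⟩, fun n ω => rfl⟩
  simp [greedyControl, k]

variable [mΩ : MeasurableSpace Ω] {P : Measure Ω}

lemma pastSigma_le (hB : ∀ n, Measurable (B n)) (n : ℕ) : pastSigma B n ≤ mΩ :=
  iSup₂_le fun k _ => (hB k).comap_le

lemma IsClosedLoop.indepFun (h : IsClosedLoop A B g x₀ X u) (hg : ∀ n, Measurable (g n))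
    (hB : ∀ n, Measurable (B n)) (hind : iIndepFun B P) (n : ℕ) : IndepFun (X n) (B n) P := by
  have := indep_iSup_of_disjoint (fun k => (hB k).comap_le) hind
    (S := Set.Iio n) (T := {n}) (by simp)
  rw [IndepFun_iff_Indep]
  refine indep_of_indep_of_le_right (indep_of_indep_of_le_left this ?_) ?_
  · exact (h.measurable_pastSigma hg n).1.comap_le
  · simp

/-- The mean shares of the squared coordinates of a uniformly distributed direction. -/
noncomputable abbrev sphereShare (q : Fin d → ℝ) (i : Fin d) : ℝ :=
  meanShare (uniformSphere d) (fun (b : EuclideanSpace ℝ (Fin d)) i => b i ^ 2) q i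

/-- Independence makes the joint law a product, so the direction can be averaged first with the
state frozen. -/
lemma lintegral_minCost_indep [IsProbabilityMeasure P] {Y D : Ω → EuclideanSpace ℝ (Fin d)}
    (hY : Measurable Y) (hD : Measurable D) (hind : IndepFun Y D P)
    (hlaw : P.map D = uniformSphere d) {q : Fin d → ℝ} (hq : ∀ i, 0 ≤ q i) (lam : Fin d → ℝ) :
    ∫⁻ ω, ENNReal.ofReal (minCost q (fun i => lam i * Y ω i) (D ω).ofLp) ∂P =
      ∫⁻ ω, ENNReal.ofReal (∑ i, q i * (1 - sphereShare q i) * (lam i * Y ω i) ^ 2) ∂P := by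
  set φ : EuclideanSpace ℝ (Fin d) × EuclideanSpace ℝ (Fin d) → ℝ≥0∞ := fun z =>
    ENNReal.ofReal (minCost q (fun i => lam i * z.1 i) z.2.ofLp) with hφ
  have hφm : Measurable φ := by
    unfold φ minCost
    fun_prop
  have h1 : ∫⁻ ω, φ (Y ω, D ω) ∂P = ∫⁻ z, φ z ∂(P.map fun ω => (Y ω, D ω)) :=
    (lintegral_map hφm (hY.prodMk hD)).symm
  have hprod := (indepFun_iff_map_prod_eq_prod_map_map hY.aemeasurable hD.aemeasurable).1 hind
  have : IsProbabilityMeasure (P.map Y) := Measure.isProbabilityMeasure_map hY.aemeasurable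
  change ∫⁻ ω, φ (Y ω, D ω) ∂P = _
  rw [h1, hprod, hlaw, lintegral_prod _ hφm.aemeasurable, lintegral_map ?_ hY]
  · refine lintegral_congr fun ω => ?_
    simp only [hφ]
    exact lintegral_minCost hq _
  · exact hφm.lintegral_prod_right'

lemma lintegral_ofReal_sum_mono {q r : Fin d → ℝ} (lam : Fin d → ℝ)
    (h : ∀ i, r i ≤ q i * (1 - sphereShare q i) * lam i ^ 2) (Y : Ω → EuclideanSpace ℝ (Fin d)) :
    ∫⁻ ω, ENNReal.ofReal (∑ i, r i * Y ω i ^ 2) ∂P ≤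
      ∫⁻ ω, ENNReal.ofReal (∑ i, q i * (1 - sphereShare q i) * (lam i * Y ω i) ^ 2) ∂P := by
  refine lintegral_mono fun ω => ENNReal.ofReal_le_ofReal (Finset.sum_le_sum fun i _ => ?_)
  rw [mul_pow, ← mul_assoc]
  exact mul_le_mul_of_nonneg_right (h i) (sq_nonneg _)

lemma lintegral_ofReal_sum_mono' {q r : Fin d → ℝ} (lam : Fin d → ℝ)
    (h : ∀ i, q i * (1 - sphereShare q i) * lam i ^ 2 ≤ r i) (Y : Ω → EuclideanSpace ℝ (Fin d)) :
    ∫⁻ ω, ENNReal.ofReal (∑ i, q i * (1 - sphereShare q i) * (lam i * Y ω i) ^ 2) ∂P ≤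
      ∫⁻ ω, ENNReal.ofReal (∑ i, r i * Y ω i ^ 2) ∂P := by
  refine lintegral_mono fun ω => ENNReal.ofReal_le_ofReal (Finset.sum_le_sum fun i _ => ?_)
  rw [mul_pow, ← mul_assoc]
  exact mul_le_mul_of_nonneg_right (h i) (sq_nonneg _)

/-- No control beats `minCost`, whose mean is at least ρ times the current mean cost. -/
lemma IsClosedLoop.geometric_le [IsProbabilityMeasure P] (hB : ∀ n, Measurable (B n))
    (hind : iIndepFun B P) (hlaw : ∀ n, P.map (B n) = uniformSphere d)
    (hg : ∀ n, Measurable (g n)) (h : IsClosedLoop (Matrix.diagonal lam) B g x₀ X u)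
    {q : Fin d → ℝ} (hq : ∀ i, 0 ≤ q i) {ρ : ℝ} (hρ : 0 ≤ ρ)
    (hqρ : ∀ i, ρ * q i ≤ q i * (1 - sphereShare q i) * lam i ^ 2) (n : ℕ) :
    ENNReal.ofReal ρ ^ n * ENNReal.ofReal (∑ i, q i * x₀ i ^ 2) ≤
      ∫⁻ ω, ENNReal.ofReal (∑ i, q i * X n ω i ^ 2) ∂P := by
  induction n with
  | zero => simp [h.init]
  | succ n ih =>
    have hXm : Measurable (X n) :=
      (h.measurable_pastSigma hg n).1.mono (pastSigma_le hB n) le_rfl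
    calc _ = ENNReal.ofReal ρ * (ENNReal.ofReal ρ ^ n * ENNReal.ofReal (∑ i, q i * x₀ i ^ 2)) := by
          rw [pow_succ']; ring
      _ ≤ ENNReal.ofReal ρ * ∫⁻ ω, ENNReal.ofReal (∑ i, q i * X n ω i ^ 2) ∂P := by gcongr
      _ = ∫⁻ ω, ENNReal.ofReal (∑ i, ρ * q i * X n ω i ^ 2) ∂P := by
          rw [← lintegral_const_mul' _ _ ENNReal.ofReal_ne_top]
          refine lintegral_congr fun ω => ?_
          rw [← ENNReal.ofReal_mul hρ, Finset.mul_sum]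
          simp only [mul_assoc]
      _ ≤ _ := lintegral_ofReal_sum_mono lam hqρ (X n)
      _ = _ := (lintegral_minCost_indep hXm (hB n) (h.indepFun hg hB hind n) (hlaw n) hq lam).symm
      _ ≤ _ := by
          refine lintegral_mono fun ω => ENNReal.ofReal_le_ofReal ?_
          simp only [h.step_apply]
          exact minCost_le hq _ _ _

/-- The greedy control attains `minCost`, so the mean cost never increases. -/
lemma IsClosedLoop.le_initial [IsProbabilityMeasure P] (hB : ∀ n, Measurable (B n))
    (hind : iIndepFun B P) (hlaw : ∀ n, P.map (B n) = uniformSphere d)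
    (hg : ∀ n, Measurable (g n)) (h : IsClosedLoop (Matrix.diagonal lam) B g x₀ X u)
    {q : Fin d → ℝ} (hq : ∀ i, 0 ≤ q i)
    (hopt : ∀ n ω, u n ω = -(∑ i, q i * B n ω i * (lam i * X n ω i)) / ∑ i, q i * B n ω i ^ 2)
    (hle : ∀ i, q i * (1 - sphereShare q i) * lam i ^ 2 ≤ q i) (n : ℕ) :
    ∫⁻ ω, ENNReal.ofReal (∑ i, q i * X n ω i ^ 2) ∂P ≤
      ENNReal.ofReal (∑ i, q i * x₀ i ^ 2) := by
  induction n with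
  | zero => simp [h.init]
  | succ n ih =>
    have hXm : Measurable (X n) :=
      (h.measurable_pastSigma hg n).1.mono (pastSigma_le hB n) le_rfl
    refine le_trans ?_ ih
    refine le_trans (le_of_eq ?_) (lintegral_ofReal_sum_mono' lam hle (X n))
    rw [← lintegral_minCost_indep hXm (hB n) (h.indepFun hg hB hind n) (hlaw n) hq lam]
    refine lintegral_congr fun ω => ?_
    simp only [h.step_apply, hopt]
    rw [minCost_eq hq]

end ClosedLoop

/-! ### Choice of weights on either side of the threshold -/

section Weights

variable {d : ℕ}

lemma exists_sphereShare_eq {p : Fin d → ℝ} (hp : p ∈ stdSimplex ℝ (Fin d)) :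
    ∃ q ∈ stdSimplex ℝ (Fin d), (∀ i, sphereShare q i = p i) ∧ ∀ i, 0 < q i ↔ 0 < p i := by
  have hm : ∀ i, Measurable fun b : EuclideanSpace ℝ (Fin d) => b i ^ 2 := fun i => by fun_prop
  have hpos : ∀ᵐ b ∂uniformSphere d, ∀ i, 0 < b i ^ 2 :=
    uniformSphere_ae_ne_zero.mono fun b hb i => sq_pos_of_ne_zero (hb i)
  obtain ⟨q, hq, hqp⟩ := exists_meanShare_eq hm hpos hp
  refine ⟨q, hq, hqp, fun i => ⟨fun h => ?_, fun h => ?_⟩⟩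
  · rw [← hqp i]
    exact meanShare_pos hm hpos hq.1 h
  · refine lt_of_le_of_ne (hq.1 i) fun h0 => ?_
    have := meanShare_eq_zero (μ := uniformSphere d)
      (c := fun (b : EuclideanSpace ℝ (Fin d)) i => b i ^ 2) h0.symm
    rw [hqp i] at this
    exact h.ne' this

/-- The share of the actuation that the `i`-th mode needs: `1 - (lam i)⁻²` if it is unstable. -/
noncomputable def demand (lam : Fin d → ℝ) (i : Fin d) : ℝ :=
  if 1 < |lam i| then 1 - (lam i ^ 2)⁻¹ else 0

lemma one_lt_sq_of_one_lt_abs {a : ℝ} (h : 1 < |a|) : 1 < a ^ 2 := by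
  rw [← sq_abs]
  nlinarith

lemma demand_nonneg (lam : Fin d → ℝ) (i : Fin d) : 0 ≤ demand lam i := by
  unfold demand
  split_ifs with h
  · exact sub_nonneg.2 (inv_le_one_of_one_le₀ (one_lt_sq_of_one_lt_abs h).le)
  · exact le_rfl

lemma sum_demand (lam : Fin d → ℝ) : ∑ i, demand lam i = numUnstable lam -
    ∑ i ∈ Finset.univ.filter (fun i => 1 < |lam i|), ((lam i) ^ 2)⁻¹ := by
  simp only [demand]
  rw [← Finset.sum_filter, Finset.sum_sub_distrib]
  simp [numUnstable]

lemma sum_inv_sq_nonneg (lam : Fin d → ℝ) :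
    0 ≤ ∑ i ∈ Finset.univ.filter (fun i => 1 < |lam i|), ((lam i) ^ 2)⁻¹ :=
  Finset.sum_nonneg fun _ _ => inv_nonneg.2 (sq_nonneg _)

lemma sum_demand_lt_one {lam : Fin d → ℝ} (h : stabilityRatio lam < 1) :
    ∑ i, demand lam i < 1 := by
  rw [sum_demand]
  unfold stabilityRatio at h
  rcases (sum_inv_sq_nonneg lam).eq_or_lt with h0 | h0
  -- A vanishing sum means that no mode is unstable, so the total demand is 0.
  · have : Finset.univ.filter (fun i => 1 < |lam i|) = ∅ := by
      by_contra hne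
      obtain ⟨i, hi⟩ := Finset.nonempty_iff_ne_empty.2 hne
      have hpos : 0 < ((lam i) ^ 2)⁻¹ :=
        inv_pos.2 (one_pos.trans (one_lt_sq_of_one_lt_abs (Finset.mem_filter.1 hi).2))
      have := Finset.single_le_sum (f := fun i => ((lam i) ^ 2)⁻¹)
        (fun i _ => inv_nonneg.2 (sq_nonneg _)) hi
      linarith
    simp [numUnstable, this]
  · rw [div_lt_one h0] at h
    linarith

lemma one_lt_sum_demand {lam : Fin d → ℝ} (h : 1 < stabilityRatio lam) :
    1 < ∑ i, demand lam i := by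
  rw [sum_demand]
  unfold stabilityRatio at h
  rcases (sum_inv_sq_nonneg lam).eq_or_lt with h0 | h0
  · rw [← h0, div_zero] at h
    exact absurd h (by norm_num)
  · rw [one_lt_div h0] at h
    linarith

lemma exists_weights_of_ratio_lt_one (hd : 1 ≤ d) {lam : Fin d → ℝ} (h : stabilityRatio lam < 1) :
    ∃ q : Fin d → ℝ, (∀ i, 0 < q i) ∧ ∀ i, q i * (1 - sphereShare q i) * lam i ^ 2 ≤ q i := by
  have hs := sum_demand_lt_one h
  have hd' : (0 : ℝ) < d := by exact_mod_cast hd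
  -- The slack is spread evenly, so that every weight is positive and the weighted cost controls the
  -- norm.
  set δ : ℝ := (1 - ∑ i, demand lam i) / d with hδ
  have hδ0 : 0 < δ := div_pos (sub_pos.2 hs) hd'
  have hp : (fun i => demand lam i + δ) ∈ stdSimplex ℝ (Fin d) := by
    refine ⟨fun i => add_nonneg (demand_nonneg lam i) hδ0.le, ?_⟩
    rw [Finset.sum_add_distrib]
    simp only [Finset.sum_const, Finset.card_univ, Fintype.card_fin, nsmul_eq_mul, hδ]
    field_simp
    ring
  obtain ⟨q, -, hqp, hpos⟩ := exists_sphereShare_eq hp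
  have hq : ∀ i, 0 < q i := fun i =>
    (hpos i).2 (add_pos_of_nonneg_of_pos (demand_nonneg lam i) hδ0)
  refine ⟨q, hq, fun i => ?_⟩
  rw [hqp, mul_assoc]
  refine mul_le_of_le_one_right (hq i).le ?_
  unfold demand
  split_ifs with hi
  · have h1 := one_lt_sq_of_one_lt_abs hi
    have h2 : (lam i ^ 2)⁻¹ * lam i ^ 2 = 1 := inv_mul_cancel₀ (by positivity)
    nlinarith
  · have h1 : lam i ^ 2 ≤ 1 := (sq_le_one_iff_abs_le_one _).2 (not_lt.1 hi)
    nlinarith [sq_nonneg (lam i)]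

lemma exists_weights_of_one_lt_ratio {lam : Fin d → ℝ} (h : 1 < stabilityRatio lam) :
    ∃ q ∈ stdSimplex ℝ (Fin d), ∃ ρ : ℝ, 1 < ρ ∧
      ∀ i, ρ * q i ≤ q i * (1 - sphereShare q i) * lam i ^ 2 := by
  have hs := one_lt_sum_demand h
  set s := ∑ i, demand lam i with hsdef
  have hs0 : 0 < s := one_pos.trans hs
  -- Dividing by `s > 1` gives each mode with positive demand strictly less than it needs, and the
  -- other modes weight zero.
  have hp : (fun i => demand lam i / s) ∈ stdSimplex ℝ (Fin d) :=
    ⟨fun i => div_nonneg (demand_nonneg lam i) hs0.le, by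
      rw [← Finset.sum_div]; exact div_self hs0.ne'⟩
  obtain ⟨q, hq, hqp, hpos⟩ := exists_sphereShare_eq hp
  have hgt : ∀ i, 0 < q i → 1 < (1 - demand lam i / s) * lam i ^ 2 := by
    intro i hi
    have hdi : 0 < demand lam i := by
      have := (hpos i).1 hi
      exact (div_pos_iff_of_pos_right hs0).1 this
    have hlt : demand lam i / s < demand lam i := div_lt_self hdi hs
    have hu : 1 < |lam i| := by
      by_contra hn
      simp [demand, hn] at hdi
    have h1 := one_lt_sq_of_one_lt_abs hu
    have h2 : (lam i ^ 2)⁻¹ * lam i ^ 2 = 1 := inv_mul_cancel₀ (by positivity)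
    have h3 : demand lam i = 1 - (lam i ^ 2)⁻¹ := by simp [demand, hu]
    have h4 : (lam i ^ 2)⁻¹ < 1 - demand lam i / s := by linarith
    nlinarith
  have hne : (Finset.univ.filter fun i => 0 < q i).Nonempty := by
    obtain ⟨i, -, hi⟩ := Finset.exists_lt_of_sum_lt (s := Finset.univ)
      (f := fun _ : Fin d => (0 : ℝ)) (g := q) (by simp [hq.2])
    exact ⟨i, by simpa using hi⟩
  -- ρ is the smallest growth factor over the modes of positive weight.
  obtain ⟨k, hk, hmin⟩ := Finset.exists_min_image _
    (fun i => (1 - demand lam i / s) * lam i ^ 2) hne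
  refine ⟨q, hq, _, hgt k (Finset.mem_filter.1 hk).2, fun i => ?_⟩
  rw [hqp, mul_comm _ (q i), mul_assoc (q i)]
  rcases (hq.1 i).eq_or_lt with h0 | h0
  · simp [← h0]
  · exact mul_le_mul_of_nonneg_left (hmin i (by simpa using h0)) h0.le

end Weights

/-! ### The two implications -/

theorem secondMomentStabilizable_of_ratio_lt_one {Ω : Type*} [MeasurableSpace Ω] (P : Measure Ω)
    [IsProbabilityMeasure P] {d : ℕ} (hd : 1 ≤ d) {B : ℕ → Ω → EuclideanSpace ℝ (Fin d)}
    (hB : ∀ n, Measurable (B n)) (hind : iIndepFun B P)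
    (hlaw : ∀ n, P.map (B n) = uniformSphere d) {lam : Fin d → ℝ}
    (h : stabilityRatio lam < 1) : SecondMomentStabilizable P (Matrix.diagonal lam) B := by
  intro x₀
  obtain ⟨q, hq, hle⟩ := exists_weights_of_ratio_lt_one hd h
  obtain ⟨X, u, hloop, hopt⟩ := exists_isClosedLoop_greedyControl (B := B) q lam x₀
  refine ⟨_, measurable_greedyControl q lam, X, u, hloop, ?_⟩
  have hbound := hloop.le_initial hB hind hlaw (measurable_greedyControl q lam)
    (fun i => (hq i).le) hopt hle
  have : Nonempty (Fin d) := ⟨⟨0, hd⟩⟩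
  -- The smallest weight converts the weighted cost into a bound on the norm.
  obtain ⟨k, hk⟩ := Finite.exists_min q
  have hnorm : ∀ x : EuclideanSpace ℝ (Fin d),
      ‖x‖ₑ ^ 2 ≤ ENNReal.ofReal (q k)⁻¹ * ENNReal.ofReal (∑ i, q i * x i ^ 2) := by
    intro x
    rw [← ENNReal.ofReal_mul (inv_nonneg.2 (hq k).le), ← ofReal_norm,
      ← ENNReal.ofReal_pow (norm_nonneg x), EuclideanSpace.real_norm_sq_eq]
    refine ENNReal.ofReal_le_ofReal ?_
    rw [le_inv_mul_iff₀ (hq k), Finset.mul_sum]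
    exact Finset.sum_le_sum fun i _ => mul_le_mul_of_nonneg_right (hk i) (sq_nonneg _)
  refine lt_of_le_of_lt (limsup_le_of_le (h := Eventually.of_forall fun n => ?_))
    (ENNReal.mul_lt_top (a := ENNReal.ofReal (q k)⁻¹) (b := ENNReal.ofReal (∑ i, q i * x₀ i ^ 2))
      ENNReal.ofReal_lt_top ENNReal.ofReal_lt_top)
  calc _ ≤ ∫⁻ ω, ENNReal.ofReal (q k)⁻¹ * ENNReal.ofReal (∑ i, q i * X n ω i ^ 2) ∂P :=
        lintegral_mono fun ω => hnorm _
    _ = ENNReal.ofReal (q k)⁻¹ * ∫⁻ ω, ENNReal.ofReal (∑ i, q i * X n ω i ^ 2) ∂P :=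
        lintegral_const_mul' _ _ ENNReal.ofReal_ne_top
    _ ≤ _ := by gcongr; exact hbound n

theorem ratio_le_one_of_secondMomentStabilizable {Ω : Type*} [MeasurableSpace Ω] (P : Measure Ω)
    [IsProbabilityMeasure P] {d : ℕ} {B : ℕ → Ω → EuclideanSpace ℝ (Fin d)}
    (hB : ∀ n, Measurable (B n)) (hind : iIndepFun B P)
    (hlaw : ∀ n, P.map (B n) = uniformSphere d) {lam : Fin d → ℝ}
    (h : SecondMomentStabilizable P (Matrix.diagonal lam) B) : stabilityRatio lam ≤ 1 := by
  by_contra! hr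
  obtain ⟨q, hq, ρ, hρ, hle⟩ := exists_weights_of_one_lt_ratio hr
  -- The all-ones initial state has weighted cost ∑ qᵢ = 1, so the growth starts from a nonzero
  -- value.
  obtain ⟨g, hg, X, u, hloop, hlim⟩ := h (WithLp.toLp 2 fun _ => 1)
  have hgrow := hloop.geometric_le hB hind hlaw hg hq.1 (one_pos.trans hρ).le hle
  simp only [one_pow, mul_one, hq.2, ENNReal.ofReal_one] at hgrow
  have hnorm : ∀ n, ENNReal.ofReal ρ ^ n ≤ ∫⁻ ω, ‖X n ω‖ₑ ^ 2 ∂P := by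
    refine fun n => (hgrow n).trans (lintegral_mono fun ω => ?_)
    rw [← ofReal_norm, ← ENNReal.ofReal_pow (norm_nonneg _),
      EuclideanSpace.real_norm_sq_eq]
    refine ENNReal.ofReal_le_ofReal (Finset.sum_le_sum fun i _ => ?_)
    refine mul_le_of_le_one_left (sq_nonneg _) ?_
    rw [← hq.2]
    exact Finset.single_le_sum (fun j _ => hq.1 j) (Finset.mem_univ i)
  have ht : Tendsto (fun n => ∫⁻ ω, ‖X n ω‖ₑ ^ 2 ∂P) atTop (nhds ∞) :=
    tendsto_of_tendsto_of_tendsto_of_le_of_le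
      (ENNReal.tendsto_pow_atTop_nhds_top_iff.2 (by simpa using hρ)) tendsto_const_nhds
      hnorm fun _ => le_top
  rw [ht.limsup_eq] at hlim
  exact lt_irrefl _ hlim

theorem theorem1 {Ω : Type*} [MeasurableSpace Ω] (P : Measure Ω) [IsProbabilityMeasure P]
    (d : ℕ) (hd : 1 ≤ d)
    (B : ℕ → Ω → EuclideanSpace ℝ (Fin d))
    (hBmeas : ∀ n, Measurable (B n))
    (hBindep : iIndepFun B P)
    (hBlaw : ∀ n, P.map (B n) = uniformSphere d)
    (lam : Fin d → ℝ) (hlam : ∀ i, |lam i| ≠ 1) :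
    (stabilityRatio lam < 1 → SecondMomentStabilizable P (Matrix.diagonal lam) B) ∧
      (SecondMomentStabilizable P (Matrix.diagonal lam) B → stabilityRatio lam ≤ 1) :=
  ⟨secondMomentStabilizable_of_ratio_lt_one P hd hBmeas hBindep hBlaw,
    ratio_le_one_of_secondMomentStabilizable P hBmeas hBindep hBlaw⟩
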